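/- Fix $n\ge 0$ and propositional variables $p_1,\dots,p_n$. An $n$-formula is built from $\bot$ and $p_1,\dots,p_n$ by $\wedge,\vee,\to$; it is a $\mathsf{NNIL}_n$-formula if no implication occurs in it to the left of an implication. Let $\vdash$ denote derivability in intuitionistic propositional logic. An $n$-color is an element of $\{0,1\}^n$; colors are ordered pointwise. An $n$-model is an intuitionistic Kripke model (nonempty, partially ordered, with persistent valuation) for the variables $p_1,\dots,p_n$; the color of a world lists the truth values of $p_1,\dots,p_n$ there. A monotonic map between models is an order-preserving, color-preserving function, and $\mathfrak N\le\mathfrak M$ means that there is a monotonic map from $\mathfrak M$ to $\mathfrak N$. The model $\mathcal T(n)$ is defined as follows. Its worlds are finite tree-like $n$-models (up to isomorphism), introduced in layers: the first layer consists of the $2^n$ one-point trees, one for each color; given the layers $\le m$, for every finite set $X$ of pairwise $\le$-incomparable trees in layers $\le m$ containing at least one tree of layer $m$, and every color $c$ strictly smaller than all colors occurring in the trees in $X$, the tree $T_w$ obtained from the disjoint union of the trees in $X$ by adding a fresh root $w$ of color $c$ below is put in layer $m+1$. The worlds of $\mathcal T(n)$ are the trees of all layers, ordered by $\le$, and the color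 of $T_w$ as a world of $\mathcal T(n)$ is the color of its root $w$. The $n$-canonical model $\mathfrak M_n^{\mathsf{NNIL}}$ has as worlds the sets $\Gamma$ of $\mathsf{NNIL}_n$-formulas such that $\Gamma\nvdash\bot$; $\Gamma\vdash\varphi$ implies $\varphi\in\Gamma$ for all $\mathsf{NNIL}_n$-formulas $\varphi$; and $\varphi\vee\psi\in\Gamma$ implies $\varphi\in\Gamma$ or $\psi\in\Gamma$. It is ordered by inclusion, and $p_i$ is true at $\Gamma$ iff $p_i\in\Gamma$. **Theorem.** $\mathcal T(n)$ and $\mathfrak M_n^{\mathsf{NNIL}}$ are $n$-models, and the map $$T_w\longmapsto \mathsf{Th}(T_w)=\{\varphi\in\mathsf{NNIL}_n \mid T_w\models\varphi\}$$ is an isomorphism of $n$-models from $\mathcal T(n)$ (with relation $\le$) onto $\mathfrak M_n^{\mathsf{NNIL}}$ (with relation $\subseteq$): it is a bijection, it preserves colors, and $T_w\le T_u$ iff $\mathsf{Th}(T_w)\subseteq\mathsf{Th}(T_u)$. Here $T_w\models\varphi$ may be read either as truth of $\varphi$ at the root $w$ of the tree $T_w$ or as truth of $\varphi$ at the world $T_w$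 of $\mathcal T(n)$; both readings give the same set $\mathsf{Th}(T_w)$. -/

import Mathlib

/-! Intuitionistic propositional logic in `n` variables. -/

/-- Formulas of intuitionistic propositional logic in the variables `p_0, …, p_{n-1}`. -/
inductive Form (n : ℕ) : Type
  | bot : Form n
  | var : Fin n → Form n
  | and : Form n → Form n → Form n
  | or : Form n → Form n → Form n
  | imp : Form n → Form n → Form n

namespace Form

/-- Formulas without any occurrence of implication. -/
def ImpFree {n : ℕ} : Form n → Prop
  | bot => True
  | var _ => True
  | and φ ψ => φ.ImpFree ∧ ψ.ImpFree
  | or φ ψ => φ.ImpFree ∧ ψ.ImpFree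
  | imp _ _ => False

/-- NNIL-formulas: no implication occurs to the left of an implication. -/
def IsNNIL {n : ℕ} : Form n → Prop
  | bot => True
  | var _ => True
  | and φ ψ => φ.IsNNIL ∧ ψ.IsNNIL
  | or φ ψ => φ.IsNNIL ∧ ψ.IsNNIL
  | imp φ ψ => φ.ImpFree ∧ ψ.IsNNIL

end Form

/-- Derivability `Γ ⊢ φ` in intuitionistic propositional logic (natural deduction). -/
inductive IPC {n : ℕ} : Set (Form n) → Form n → Prop
  | ax {Γ : Set (Form n)} {φ : Form n} : φ ∈ Γ → IPC Γ φ
  | botE {Γ : Set (Form n)} {φ : Form n} : IPC Γ Form.bot → IPC Γ φ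
  | andI {Γ : Set (Form n)} {φ ψ : Form n} : IPC Γ φ → IPC Γ ψ → IPC Γ (φ.and ψ)
  | andE₁ {Γ : Set (Form n)} {φ ψ : Form n} : IPC Γ (φ.and ψ) → IPC Γ φ
  | andE₂ {Γ : Set (Form n)} {φ ψ : Form n} : IPC Γ (φ.and ψ) → IPC Γ ψ
  | orI₁ {Γ : Set (Form n)} {φ ψ : Form n} : IPC Γ φ → IPC Γ (φ.or ψ)
  | orI₂ {Γ : Set (Form n)} {φ ψ : Form n} : IPC Γ ψ → IPC Γ (φ.or ψ)
  | orE {Γ : Set (Form n)} {φ ψ χ : Form n} :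
      IPC Γ (φ.or ψ) → IPC (insert φ Γ) χ → IPC (insert ψ Γ) χ → IPC Γ χ
  | impI {Γ : Set (Form n)} {φ ψ : Form n} : IPC (insert φ Γ) ψ → IPC Γ (φ.imp ψ)
  | impE {Γ : Set (Form n)} {φ ψ : Form n} : IPC Γ (φ.imp ψ) → IPC Γ φ → IPC Γ ψ

/-! Kripke `n`-models. -/

/-- An `n`-color: a 0-1-sequence of length `n`. Colors are ordered pointwise. -/
abbrev Color (n : ℕ) : Type := Fin n → Bool

/-- The data of a Kripke `n`-model. The valuation is recorded by the color of each world: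
`p_i` is true at `w` iff `col w i = true`. -/
structure KModel (n : ℕ) : Type 1 where
  World : Type
  rel : World → World → Prop
  col : World → Color n

namespace KModel

variable {n : ℕ}

/-- The laws of an intuitionistic Kripke model: there is a world, the accessibility relation is
a partial order and the valuation is persistent. -/
structure IsIntuitionistic (M : KModel n) : Prop where
  nonempty : Nonempty M.World
  refl : ∀ w, M.rel w w
  trans : ∀ w u v, M.rel w u → M.rel u v → M.rel w v
  antisymm : ∀ w u, M.rel w u → M.rel u w → w = u
  persistent : ∀ w u, M.rel w u → M.col w ≤ M.col u

/-- `M, w ⊨ φ`. -/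
def Forces (M : KModel n) : M.World → Form n → Prop
  | _, .bot => False
  | w, .var i => M.col w i = true
  | w, .and φ ψ => M.Forces w φ ∧ M.Forces w ψ
  | w, .or φ ψ => M.Forces w φ ∨ M.Forces w ψ
  | w, .imp φ ψ => ∀ u, M.rel w u → M.Forces u φ → M.Forces u ψ

/-- Monotonic maps between models: order and color preserving functions. -/
structure IsMonotonic (M N : KModel n) (f : M.World → N.World) : Prop where
  map_rel : ∀ w u, M.rel w u → N.rel (f w) (f u)
  map_col : ∀ w, N.col (f w) = M.col w

/-- `N ≤ M`: the model `M` can be mapped monotonically into `N`. -/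
def Le (N M : KModel n) : Prop := ∃ f : M.World → N.World, IsMonotonic M N f

/-- Isomorphisms of models. -/
structure Iso (M N : KModel n) where
  toEquiv : M.World ≃ N.World
  map_rel : ∀ w u, N.rel (toEquiv w) (toEquiv u) ↔ M.rel w u
  map_col : ∀ w, N.col (toEquiv w) = M.col w

/-- The order of the disjoint union of the models `M i` with a fresh root `none` below. -/
inductive GraftRel {k : ℕ} (M : Fin k → KModel n) :
    Option (Σ i, (M i).World) → Option (Σ i, (M i).World) → Prop
  | root (x : Option (Σ i, (M i).World)) : GraftRel M none x
  | branch (i : Fin k) (a b : (M i).World) :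
      (M i).rel a b → GraftRel M (some ⟨i, a⟩) (some ⟨i, b⟩)

/-- The disjoint union of the models `M i` with a fresh root of color `c` added below. -/
def graft (c : Color n) {k : ℕ} (M : Fin k → KModel n) : KModel n where
  World := Option (Σ i, (M i).World)
  rel := GraftRel M
  col
    | none => c
    | some x => (M x.1).col x.2

/-- The identity isomorphism. -/
def Iso.refl (M : KModel n) : Iso M M := ⟨Equiv.refl _, fun _ _ => Iff.rfl, fun _ => rfl⟩

/-- The inverse isomorphism. -/
def Iso.symm {M N : KModel n} (e : Iso M N) : Iso N M where
  toEquiv := e.toEquiv.symm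
  map_rel w u := by simpa using (e.map_rel (e.toEquiv.symm w) (e.toEquiv.symm u)).symm
  map_col w := by simpa using (e.map_col (e.toEquiv.symm w)).symm

/-- The composition of isomorphisms. -/
def Iso.trans {M N K : KModel n} (e : Iso M N) (d : Iso N K) : Iso M K where
  toEquiv := e.toEquiv.trans d.toEquiv
  map_rel _ _ := (d.map_rel _ _).trans (e.map_rel _ _)
  map_col _ := (d.map_col _).trans (e.map_col _)

theorem Iso.isMonotonic {M N : KModel n} (e : Iso M N) : IsMonotonic M N e.toEquiv :=
  ⟨fun w u h => (e.map_rel w u).2 h, e.map_col⟩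

theorem IsMonotonic.comp {M N K : KModel n} {g : N.World → K.World} {f : M.World → N.World}
    (hg : IsMonotonic N K g) (hf : IsMonotonic M N f) : IsMonotonic M K (g ∘ f) :=
  ⟨fun w u h => hg.map_rel _ _ (hf.map_rel w u h), fun w => (hg.map_col _).trans (hf.map_col w)⟩

theorem Le.trans {M N K : KModel n} : Le M N → Le N K → Le M K
  | ⟨g, hg⟩, ⟨f, hf⟩ => ⟨g ∘ f, hg.comp hf⟩

theorem Iso.le {M N : KModel n} (e : Iso M N) : Le N M := ⟨_, e.isMonotonic⟩

end KModel

/-! The trees of the universal model. -/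

/-- Finite colored trees: a root color and a finite family of immediate subtrees. -/
inductive CTree (n : ℕ) : Type
  | node (c : Color n) (k : ℕ) (sub : Fin k → CTree n) : CTree n

namespace CTree

variable {n : ℕ}

/-- The tree-like model given by a colored tree. -/
def model : CTree n → KModel n
  | node c _ sub => KModel.graft c fun i => (sub i).model

/-- The root of the tree. -/
def root : (t : CTree n) → t.model.World
  | node _ _ _ => none

/-- The color of the root. -/
def color : CTree n → Color n
  | node c _ _ => c

/-- `InLayer m t`: the tree `t` belongs to the `m`-th layer, `m ≥ 1`. The first layer consists of
the one-point trees. A tree in layer `m + 1` arises from pairwise incomparable trees in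
layers `≤ m`, at least one of them in layer `m`, by adding below their disjoint union a fresh root
whose color is strictly smaller than all colors occurring in them. -/
inductive InLayer : ℕ → CTree n → Prop
  | single (c : Color n) (sub : Fin 0 → CTree n) : InLayer 1 (node c 0 sub)
  | step (m k : ℕ) (c : Color n) (sub : Fin k → CTree n) (l : Fin k → ℕ)
      (hl : ∀ i, l i ≤ m) (hsub : ∀ i, InLayer (l i) (sub i)) (hm : ∃ i, l i = m)
      (hinc : ∀ i j, i ≠ j → ¬ KModel.Le (sub i).model (sub j).model)
      (hc : ∀ i, ∀ x : (sub i).model.World, c < (sub i).model.col x) :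
      InLayer (m + 1) (node c k sub)

theorem col_root (t : CTree n) : t.model.col t.root = t.color := by
  cases t; rfl

theorem root_rel (t : CTree n) (x : t.model.World) : t.model.rel t.root x := by
  cases t; exact KModel.GraftRel.root x

theorem eq_root_of_rel (t : CTree n) (x : t.model.World) (h : t.model.rel x t.root) :
    x = t.root := by
  cases t
  change KModel.GraftRel _ x none at h
  cases h
  rfl

theorem color_eq_of_iso {t u : CTree n} (e : KModel.Iso t.model u.model) : t.color = u.color := by
  have h : e.toEquiv t.root = u.root := by
    apply eq_root_of_rel
    have := (e.map_rel t.root (e.toEquiv.symm u.root)).2 (root_rel t _)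
    simpa using this
  rw [← col_root t, ← col_root u, ← h, e.map_col]

/-- `Th(t)`: the NNIL-formulas in `n` variables that are true at the root of the tree `t`. -/
def theory (t : CTree n) : Set (Form n) := {φ | φ.IsNNIL ∧ t.model.Forces t.root φ}

end CTree

/-- The trees that belong to some layer. -/
def LayerTree (n : ℕ) : Type := {t : CTree n // ∃ m, CTree.InLayer m t}

/-- Trees are identified when they are isomorphic as models (the order in which a colored tree
lists its immediate subtrees is irrelevant). -/
instance LayerTree.setoid (n : ℕ) : Setoid (LayerTree n) where
  r t u := Nonempty (KModel.Iso t.1.model u.1.model)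
  iseqv :=
    ⟨fun t => ⟨KModel.Iso.refl t.1.model⟩, fun ⟨e⟩ => ⟨e.symm⟩, fun ⟨e⟩ ⟨d⟩ => ⟨e.trans d⟩⟩

/-- The model `T(n)`: its worlds are the trees of all layers, up to isomorphism, ordered by `≤`;
the color of a tree is the color of its root. -/
def universalModel (n : ℕ) : KModel n where
  World := Quotient (LayerTree.setoid n)
  rel := Quotient.lift₂ (fun t u => KModel.Le t.1.model u.1.model)
    (by
      rintro t u t' u' ⟨e⟩ ⟨d⟩
      exact propext ⟨fun h => e.le.trans (h.trans d.symm.le),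
        fun h => e.symm.le.trans (h.trans d.le)⟩)
  col := Quotient.lift (fun t => t.1.color)
    (by
      rintro t u ⟨e⟩
      exact CTree.color_eq_of_iso e)

/-! The canonical model. -/

/-- Consistent theories of NNIL-formulas in `n` variables with the disjunction property. -/
structure IsPrimeNNILTheory {n : ℕ} (Γ : Set (Form n)) : Prop where
  isNNIL : ∀ φ ∈ Γ, φ.IsNNIL
  consistent : ¬ IPC Γ Form.bot
  closed : ∀ φ : Form n, φ.IsNNIL → IPC Γ φ → φ ∈ Γ
  disj : ∀ φ ψ : Form n, φ.or ψ ∈ Γ → φ ∈ Γ ∨ ψ ∈ Γ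

open Classical in
/-- The `n`-canonical model of NNIL-formulas: consistent theories with the disjunction property,
ordered by inclusion; `p_i` is true at `Γ` iff `p_i ∈ Γ`. -/
noncomputable def canonicalModel (n : ℕ) : KModel n where
  World := {Γ : Set (Form n) // IsPrimeNNILTheory Γ}
  rel Γ Δ := Γ.1 ⊆ Δ.1
  col Γ i := decide (Form.var i ∈ Γ.1)

variable {n : ℕ}

/-! Natural deduction. -/

/-! Monotonic maps reflect NNIL-formulas, because an implication-free antecedent depends on the
color alone (`IsMonotonic.forces_of_forces`); so `≤` between trees gives inclusion of theories.
Conversely, if the theory of a world `x` of a finite model is included in that of `v`, then some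
world above `x` has the color of `v` and a theory still included in that of `v`
(`IsIntuitionistic.exists_rel_of_theoryAt_subset`). Otherwise finitely many counterexamples would
combine into one NNIL-formula true at `x` and false at `v`. Repeating this up a tree builds a
monotonic map. Trees that are `≤` each other are isomorphic, since immediate subtrees are pairwise
incomparable. Hence `Th` is an order embedding.

For surjectivity, the theory of a world is determined by its color and the theories at worlds of
strictly larger color above it (`IsIntuitionistic.theoryAt_subset`). Colors being finite in number,
a model realizes only finitely many theories, and induction from large colors to small realizes each
by a tree: graft trees for the minimal theories of larger color (`CTree.exists_theory_eq`). In the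
canonical model the truth lemma identifies a world with its theory, so every prime theory is
reached. -/

theorem Form.ImpFree.isNNIL {φ : Form n} (h : φ.ImpFree) : φ.IsNNIL := by
  induction φ with
  | bot => trivial
  | var i => trivial
  | and φ ψ ihφ ihψ => exact ⟨ihφ h.1, ihψ h.2⟩
  | or φ ψ ihφ ihψ => exact ⟨ihφ h.1, ihψ h.2⟩
  | imp φ ψ => exact h.elim

namespace IPC

theorem mono {Γ Δ : Set (Form n)} {φ : Form n} (h : IPC Γ φ) (hs : Γ ⊆ Δ) : IPC Δ φ := by
  induction h generalizing Δ with
  | ax h => exact ax (hs h)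
  | botE _ ih => exact botE (ih hs)
  | andI _ _ ih₁ ih₂ => exact andI (ih₁ hs) (ih₂ hs)
  | andE₁ _ ih => exact andE₁ (ih hs)
  | andE₂ _ ih => exact andE₂ (ih hs)
  | orI₁ _ ih => exact orI₁ (ih hs)
  | orI₂ _ ih => exact orI₂ (ih hs)
  | orE _ _ _ ih₁ ih₂ ih₃ =>
    exact orE (ih₁ hs) (ih₂ (Set.insert_subset_insert hs)) (ih₃ (Set.insert_subset_insert hs))
  | impI _ ih => exact impI (ih (Set.insert_subset_insert hs))
  | impE _ _ ih₁ ih₂ => exact impE (ih₁ hs) (ih₂ hs)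

theorem cut {Γ : Set (Form n)} {φ ψ : Form n} (hφ : IPC Γ φ) (hψ : IPC (insert φ Γ) ψ) :
    IPC Γ ψ :=
  impE (impI hψ) hφ

/-- Serves the rules that discharge an assumption: `φ` is removed from the finite set and restored
as the discharged premise. -/
theorem exists_finite_of_insert {Γ : Set (Form n)} {φ ψ : Form n}
    (h : ∃ s ⊆ insert φ Γ, s.Finite ∧ IPC s ψ) : ∃ s ⊆ Γ, s.Finite ∧ IPC (insert φ s) ψ := by
  obtain ⟨s, hs, hfin, hψ⟩ := h
  exact ⟨s \ {φ}, by simpa [Set.sdiff_subset_iff] using hs, hfin.sdiff,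
    hψ.mono (by simp)⟩

/-- Compactness of derivability. -/
theorem exists_finite {Γ : Set (Form n)} {φ : Form n} (h : IPC Γ φ) :
    ∃ s ⊆ Γ, s.Finite ∧ IPC s φ := by
  induction h with
  | @ax Γ φ h => exact ⟨{φ}, by simpa using h, Set.finite_singleton φ, ax rfl⟩
  | botE _ ih => obtain ⟨s, hs, hf, h⟩ := ih; exact ⟨s, hs, hf, botE h⟩
  | andE₁ _ ih => obtain ⟨s, hs, hf, h⟩ := ih; exact ⟨s, hs, hf, andE₁ h⟩
  | andE₂ _ ih => obtain ⟨s, hs, hf, h⟩ := ih; exact ⟨s, hs, hf, andE₂ h⟩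
  | orI₁ _ ih => obtain ⟨s, hs, hf, h⟩ := ih; exact ⟨s, hs, hf, orI₁ h⟩
  | orI₂ _ ih => obtain ⟨s, hs, hf, h⟩ := ih; exact ⟨s, hs, hf, orI₂ h⟩
  | andI _ _ ih₁ ih₂ =>
    obtain ⟨s, hs, hf, h⟩ := ih₁
    obtain ⟨s', hs', hf', h'⟩ := ih₂
    exact ⟨s ∪ s', Set.union_subset hs hs', hf.union hf',
      andI (h.mono Set.subset_union_left) (h'.mono Set.subset_union_right)⟩
  | impE _ _ ih₁ ih₂ =>
    obtain ⟨s, hs, hf, h⟩ := ih₁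
    obtain ⟨s', hs', hf', h'⟩ := ih₂
    exact ⟨s ∪ s', Set.union_subset hs hs', hf.union hf',
      impE (h.mono Set.subset_union_left) (h'.mono Set.subset_union_right)⟩
  | impI _ ih =>
    obtain ⟨s, hs, hf, h⟩ := exists_finite_of_insert ih
    exact ⟨s, hs, hf, impI h⟩
  | orE _ _ _ ih₁ ih₂ ih₃ =>
    obtain ⟨s₁, hs₁, hf₁, h₁⟩ := ih₁
    obtain ⟨s₂, hs₂, hf₂, h₂⟩ := exists_finite_of_insert ih₂
    obtain ⟨s₃, hs₃, hf₃, h₃⟩ := exists_finite_of_insert ih₃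
    refine ⟨s₁ ∪ s₂ ∪ s₃, Set.union_subset (Set.union_subset hs₁ hs₂) hs₃,
      (hf₁.union hf₂).union hf₃, orE (h₁.mono fun x hx => .inl (.inl hx))
        (h₂.mono (Set.insert_subset_insert fun x hx => .inl (.inr hx)))
        (h₃.mono (Set.insert_subset_insert fun x hx => .inr hx))⟩

/-- A set of NNIL-formulas that does not derive `ψ` extends to a prime theory without `ψ`. -/
theorem exists_isPrimeNNILTheory {Γ : Set (Form n)} {ψ : Form n} (hΓ : ∀ φ ∈ Γ, φ.IsNNIL)
    (h : ¬ IPC Γ ψ) : ∃ Δ, Γ ⊆ Δ ∧ IsPrimeNNILTheory Δ ∧ ψ ∉ Δ := by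
  obtain ⟨Δ, hΓΔ, hmax⟩ := zorn_subset_nonempty
    {Δ : Set (Form n) | (∀ φ ∈ Δ, φ.IsNNIL) ∧ ¬ IPC Δ ψ}
    (fun C hC hchain hne => ⟨⋃₀ C, ⟨fun φ ⟨s, hs, hφ⟩ => (hC hs).1 φ hφ, fun hd => by
      obtain ⟨s, hs, hf, hd⟩ := hd.exists_finite
      obtain ⟨t, ht, hst⟩ := hchain.directedOn.exists_mem_subset_of_finite_of_subset_sUnion hne hf hs
      exact (hC ht).2 (hd.mono hst)⟩, fun s hs => Set.subset_sUnion_of_mem hs⟩) Γ ⟨hΓ, h⟩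
  obtain ⟨hΔ, hψ⟩ := hmax.prop
  -- Maximality is only among sets of NNIL-formulas, so `φ` has to be NNIL for the enlarged set to
  -- compete.
  have key : ∀ φ : Form n, φ.IsNNIL → φ ∉ Δ → IPC (insert φ Δ) ψ := by
    intro φ hφ hn
    by_contra hc
    refine hn (hmax.le_of_ge (y := insert φ Δ) ⟨?_, hc⟩ (Set.subset_insert φ Δ)
      (Set.mem_insert φ Δ))
    rintro χ (rfl | hχ)
    exacts [hφ, hΔ χ hχ]
  refine ⟨Δ, hΓΔ, ⟨hΔ, fun hb => hψ (botE hb), fun φ hφ hd => ?_, fun φ χ hor => ?_⟩,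
    fun hm => hψ (ax hm)⟩
  · by_contra hn
    exact hψ (cut hd (key φ hφ hn))
  · by_contra! hc
    have hnn : φ.IsNNIL ∧ χ.IsNNIL := hΔ _ hor
    exact hψ (orE (ax hor) (key φ hnn.1 hc.1) (key χ hnn.2 hc.2))

end IPC

/-! Forcing in intuitionistic models. -/

namespace KModel

theorem IsIntuitionistic.forces_mono {M : KModel n} (hM : M.IsIntuitionistic) {w v : M.World}
    (hwv : M.rel w v) {φ : Form n} (h : M.Forces w φ) : M.Forces v φ := by
  induction φ with
  | bot => exact h
  | var i => exact hM.persistent w v hwv i h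
  | and φ ψ ihφ ihψ => exact ⟨ihφ h.1, ihψ h.2⟩
  | or φ ψ ihφ ihψ => exact h.imp ihφ ihψ
  | imp φ ψ => exact fun u hu => h u (hM.trans _ _ _ hwv hu)

theorem IsIntuitionistic.forces_of_ipc {M : KModel n} (hM : M.IsIntuitionistic)
    {Γ : Set (Form n)} {φ : Form n} (h : IPC Γ φ) :
    ∀ w, (∀ γ ∈ Γ, M.Forces w γ) → M.Forces w φ := by
  have hins : ∀ {Γ : Set (Form n)} {φ : Form n} {w u : M.World}, M.rel w u →
      (∀ γ ∈ Γ, M.Forces w γ) → M.Forces u φ → ∀ γ ∈ insert φ Γ, M.Forces u γ := by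
    rintro Γ φ w u hwu hw hu γ (rfl | hγ)
    exacts [hu, hM.forces_mono hwu (hw γ hγ)]
  induction h with
  | ax h => exact fun w hw => hw _ h
  | botE _ ih => exact fun w hw => (ih w hw).elim
  | andI _ _ ih₁ ih₂ => exact fun w hw => ⟨ih₁ w hw, ih₂ w hw⟩
  | andE₁ _ ih => exact fun w hw => (ih w hw).1
  | andE₂ _ ih => exact fun w hw => (ih w hw).2
  | orI₁ _ ih => exact fun w hw => .inl (ih w hw)
  | orI₂ _ ih => exact fun w hw => .inr (ih w hw)
  | orE _ _ _ ih₁ ih₂ ih₃ =>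
    exact fun w hw => (ih₁ w hw).elim (fun h => ih₂ w (hins (hM.refl w) hw h))
      fun h => ih₃ w (hins (hM.refl w) hw h)
  | impI _ ih => exact fun w hw u hu hφ => ih u (hins hu hw hφ)
  | impE _ _ ih₁ ih₂ => exact fun w hw => ih₁ w hw w (hM.refl w) (ih₂ w hw)

theorem forces_iff_of_impFree {M N : KModel n} {w : M.World} {v : N.World}
    (h : M.col w = N.col v) {φ : Form n} (hφ : φ.ImpFree) : M.Forces w φ ↔ N.Forces v φ := by
  induction φ with
  | bot => exact Iff.rfl
  | var i => exact by simp only [Forces, h]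
  | and φ ψ ihφ ihψ => exact and_congr (ihφ hφ.1) (ihψ hφ.2)
  | or φ ψ ihφ ihψ => exact or_congr (ihφ hφ.1) (ihψ hφ.2)
  | imp φ ψ => exact hφ.elim

/-- The NNIL-formulas that are true at a world. -/
def theoryAt (M : KModel n) (w : M.World) : Set (Form n) := {φ | φ.IsNNIL ∧ M.Forces w φ}

theorem IsIntuitionistic.theoryAt_mono {M : KModel n} (hM : M.IsIntuitionistic) {w v : M.World}
    (h : M.rel w v) : M.theoryAt w ⊆ M.theoryAt v :=
  fun _ hφ => ⟨hφ.1, hM.forces_mono h hφ.2⟩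

theorem col_le_of_theoryAt_subset {M N : KModel n} {w : M.World} {v : N.World}
    (h : M.theoryAt w ⊆ N.theoryAt v) : M.col w ≤ N.col v :=
  fun i hi => (h (a := .var i) ⟨trivial, hi⟩).2

theorem col_eq_of_theoryAt_eq {M N : KModel n} {w : M.World} {v : N.World}
    (h : M.theoryAt w = N.theoryAt v) : M.col w = N.col v :=
  le_antisymm (col_le_of_theoryAt_subset h.subset) (col_le_of_theoryAt_subset h.superset)

theorem IsIntuitionistic.isPrimeNNILTheory_theoryAt {M : KModel n} (hM : M.IsIntuitionistic)
    (w : M.World) : IsPrimeNNILTheory (M.theoryAt w) where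
  isNNIL _ h := h.1
  consistent h := hM.forces_of_ipc h w fun _ hγ => hγ.2
  closed _ hφ h := ⟨hφ, hM.forces_of_ipc h w fun _ hγ => hγ.2⟩
  disj _ _ h := h.2.imp (fun h' => ⟨h.1.1, h'⟩) fun h' => ⟨h.1.2, h'⟩

/-- NNIL-formulas are reflected by monotonic maps. -/
theorem IsMonotonic.forces_of_forces {M N : KModel n} {f : M.World → N.World}
    (hf : IsMonotonic M N f) {φ : Form n} (hφ : φ.IsNNIL) {w : M.World}
    (h : N.Forces (f w) φ) : M.Forces w φ := by
  induction φ generalizing w with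
  | bot => exact h
  | var i => exact (forces_iff_of_impFree (hf.map_col w).symm (φ := .var i) trivial).2 h
  | and φ ψ ihφ ihψ => exact ⟨ihφ hφ.1 h.1, ihψ hφ.2 h.2⟩
  | or φ ψ ihφ ihψ => exact h.imp (ihφ hφ.1) (ihψ hφ.2)
  | imp φ ψ _ ihψ =>
    exact fun u hu hu' => ihψ hφ.2 (h (f u) (hf.map_rel w u hu)
      ((forces_iff_of_impFree (hf.map_col u) hφ.1).2 hu'))

/-- Monotonic maps with the lifting property (p-morphisms) preserve and reflect forcing. -/
theorem IsMonotonic.forces_iff {M N : KModel n} {f : M.World → N.World}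
    (hf : IsMonotonic M N f) (hlift : ∀ w y, N.rel (f w) y → ∃ u, M.rel w u ∧ f u = y)
    {φ : Form n} {w : M.World} : N.Forces (f w) φ ↔ M.Forces w φ := by
  induction φ generalizing w with
  | bot => exact Iff.rfl
  | var i => exact forces_iff_of_impFree (hf.map_col w) (φ := .var i) trivial
  | and φ ψ ihφ ihψ => exact and_congr ihφ ihψ
  | or φ ψ ihφ ihψ => exact or_congr ihφ ihψ
  | imp φ ψ ihφ ihψ =>
    constructor
    · exact fun h u hu hu' => ihψ.1 (h (f u) (hf.map_rel w u hu) (ihφ.2 hu'))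
    · intro h y hy hy'
      obtain ⟨u, hu, rfl⟩ := hlift w y hy
      exact ihψ.2 (h u hu (ihφ.1 hy'))

theorem Iso.forces_iff {M N : KModel n} (e : Iso M N) {φ : Form n} {w : M.World} :
    N.Forces (e.toEquiv w) φ ↔ M.Forces w φ :=
  e.isMonotonic.forces_iff fun w y hy =>
    ⟨e.toEquiv.symm y, (e.map_rel _ _).1 (by simpa using hy), by simp⟩

/-- The theory of a world is determined by its color and the theories of the worlds of larger
color above it. -/
theorem IsIntuitionistic.theoryAt_subset {M N : KModel n} (hM : M.IsIntuitionistic)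
    (hN : N.IsIntuitionistic) {w : M.World} {v : N.World} (hcol : M.col w = N.col v)
    (h : ∀ u, M.rel w u → M.col w < M.col u → ∃ x, N.rel v x ∧ N.theoryAt x ⊆ M.theoryAt u) :
    N.theoryAt v ⊆ M.theoryAt w := by
  rintro φ ⟨hφ, hv⟩
  refine ⟨hφ, ?_⟩
  induction φ with
  | bot => exact hv
  | var i => exact (forces_iff_of_impFree hcol (φ := .var i) trivial).2 hv
  | and φ ψ ihφ ihψ => exact ⟨ihφ hφ.1 hv.1, ihψ hφ.2 hv.2⟩
  | or φ ψ ihφ ihψ => exact hv.imp (ihφ hφ.1) (ihψ hφ.2)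
  | imp φ ψ _ ihψ =>
    intro u hu hu'
    -- If the color has not grown, the antecedent already holds at `v`, so the conclusion passes
    -- from `v` to `w` by induction and persists to `u`. If it has grown, the whole implication
    -- moves to `x` and from there to `u`.
    rcases eq_or_lt_of_le (hM.persistent w u hu) with heq | hlt
    · exact hM.forces_mono hu (ihψ hφ.2
        (hv v (hN.refl v) ((forces_iff_of_impFree (heq.symm.trans hcol) hφ.1).1 hu')))
    · obtain ⟨x, hx, hxu⟩ := h u hu hlt
      exact (hxu ⟨hφ, hN.forces_mono hx hv⟩).2 u (hM.refl u) hu'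

/-! Finitely many theories. -/

/-- Downward induction on colors: with the color fixed, the theory is a function of the set of
theories of larger color seen above, and that is a subset of a finite set. -/
theorem IsIntuitionistic.finite_theoryAt_of_col {M : KModel n} (hM : M.IsIntuitionistic)
    (c : Color n) : {T | ∃ w, M.col w = c ∧ M.theoryAt w = T}.Finite := by
  induction c using WellFoundedGT.induction with
  | ind c ih =>
    let above : M.World → Set (Set (Form n)) := fun w =>
      {T | ∃ v, M.rel w v ∧ M.col w < M.col v ∧ M.theoryAt v = T}
    let W : Set M.World := {w | M.col w = c}
    have hfin : (⋃ d ∈ Set.Ioi c, {T | ∃ w, M.col w = d ∧ M.theoryAt w = T}).Finite :=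
      (Set.toFinite _).biUnion ih
    have himage : (above '' W).Finite := by
      refine hfin.finite_subsets.subset ?_
      rintro _ ⟨w, hw, rfl⟩ T ⟨v, -, hlt, rfl⟩
      exact Set.mem_biUnion (hw.symm.trans_lt hlt) ⟨v, rfl, rfl⟩
    have hdet : ∀ w ∈ W, ∀ v ∈ W, above w = above v → M.theoryAt w ⊆ M.theoryAt v := by
      intro w hw v hv heq
      refine hM.theoryAt_subset hM (hv.trans hw.symm) fun u hu hlt => ?_
      obtain ⟨x, hx, -, hxu⟩ : M.theoryAt u ∈ above w := heq ▸ ⟨u, hu, hlt, rfl⟩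
      exact ⟨x, hx, hxu.subset⟩
    -- All theories in this union coincide by `hdet`; the union names their common value without a
    -- choice of world.
    refine (himage.image fun S => ⋃ w ∈ {w ∈ W | above w = S}, M.theoryAt w).subset ?_
    rintro _ ⟨w, hw, rfl⟩
    refine ⟨above w, ⟨w, hw, rfl⟩, Set.Subset.antisymm ?_ ?_⟩
    · exact Set.iUnion₂_subset fun v hv => hdet v hv.1 w hw hv.2
    · exact Set.subset_biUnion_of_mem (s := {v ∈ W | above v = above w}) ⟨hw, rfl⟩

theorem IsIntuitionistic.finite_range_theoryAt {M : KModel n} (hM : M.IsIntuitionistic) :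
    (Set.range M.theoryAt).Finite :=
  (Set.finite_iUnion hM.finite_theoryAt_of_col).subset fun _ ⟨w, hw⟩ =>
    Set.mem_iUnion.2 ⟨M.col w, w, rfl, hw⟩

/-! Finite models and NNIL-formulas. -/

theorem exists_isNNIL_forces_iff_exists {s : Set (Form n)} (hs : s.Finite)
    (hnn : ∀ φ ∈ s, φ.IsNNIL) : ∃ χ : Form n, χ.IsNNIL ∧
      ∀ (M : KModel n) (w : M.World), M.Forces w χ ↔ ∃ φ ∈ s, M.Forces w φ := by
  induction s, hs using Set.Finite.induction_on with
  | empty => exact ⟨.bot, trivial, fun M w => by simp [Forces]⟩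
  | @insert φ s _ _ ih =>
    obtain ⟨χ, hχ, h⟩ := ih fun ψ hψ => hnn ψ (.inr hψ)
    exact ⟨.or φ χ, ⟨hnn φ (.inl rfl), hχ⟩, fun M w => by simp [Forces, h]⟩

theorem exists_isNNIL_forces_iff_forall (s : Finset (Fin n)) {χ : Form n} (hχ : χ.IsNNIL) :
    ∃ φ : Form n, φ.IsNNIL ∧ ∀ (M : KModel n), M.IsIntuitionistic → ∀ w, M.Forces w φ ↔
      ∀ u, M.rel w u → (∀ i ∈ s, M.col u i = true) → M.Forces u χ := by
  induction s using Finset.induction_on with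
  | empty =>
    exact ⟨χ, hχ, fun M hM w => ⟨fun h u hu _ => hM.forces_mono hu h,
      fun h => h w (hM.refl w) (by simp)⟩⟩
  | insert i s _ ih =>
    obtain ⟨φ, hφ, h⟩ := ih
    refine ⟨.imp (.var i) φ, ⟨trivial, hφ⟩, fun M hM w => ⟨fun hw u hu hs => ?_,
      fun hw u hu hi => (h M hM u).2 fun x hx hs => hw x (hM.trans _ _ _ hu hx) ?_⟩⟩
    · exact (h M hM u).1 (hw u hu (hs i (by simp))) u (hM.refl u)
        fun j hj => hs j (by simp [hj])
    · simp only [Finset.mem_insert, forall_eq_or_imp]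
      exact ⟨hM.persistent u x hx i hi, hs⟩

/-- Finiteness of `N` makes the disjunction of all separating formulas a formula. Restricting it to
worlds where the variables of `v` hold costs only implications with atomic antecedents. -/
theorem IsIntuitionistic.exists_rel_of_theoryAt_subset {M N : KModel n}
    (hM : M.IsIntuitionistic) (hN : N.IsIntuitionistic) [Finite N.World] {x : N.World}
    {v : M.World} (h : N.theoryAt x ⊆ M.theoryAt v) :
    ∃ y, N.rel x y ∧ N.col y = M.col v ∧ N.theoryAt y ⊆ M.theoryAt v := by
  by_contra! hc
  have hsep : ∀ y : {y // N.rel x y ∧ N.col y = M.col v},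
      ∃ φ : Form n, φ.IsNNIL ∧ N.Forces y φ ∧ ¬ M.Forces v φ := by
    rintro ⟨y, hy, hcol⟩
    obtain ⟨φ, hφ, hφ'⟩ := Set.not_subset.1 (hc y hy hcol)
    exact ⟨φ, hφ.1, hφ.2, fun hf => hφ' ⟨hφ.1, hf⟩⟩
  choose sep hnn hy hv using hsep
  obtain ⟨χ, hχ, hχ'⟩ := exists_isNNIL_forces_iff_exists
    (s := Set.range sep ∪ Form.var '' {i | M.col v i = false})
    ((Set.finite_range sep).union (Set.toFinite _)) (by
      rintro _ (⟨y, rfl⟩ | ⟨i, -, rfl⟩)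
      exacts [hnn y, trivial])
  obtain ⟨φ, hφ, hφ'⟩ :=
    exists_isNNIL_forces_iff_forall (Finset.univ.filter fun i => M.col v i = true) hχ
  have hx : N.Forces x φ := by
    refine (hφ' N hN x).2 fun y hxy hcol => (hχ' N y).2 ?_
    -- Here `y` makes at least the variables of `v` true. Either its color is that of `v` and its
    -- separating formula holds, or it makes an extra variable true, which is also a disjunct.
    by_cases heq : N.col y = M.col v
    · exact ⟨_, .inl ⟨⟨y, hxy, heq⟩, rfl⟩, hy ⟨y, hxy, heq⟩⟩
    · obtain ⟨i, hi⟩ := Function.ne_iff.1 heq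
      rcases hb : M.col v i with _ | _
      · exact ⟨.var i, .inr ⟨i, hb, rfl⟩, by simpa [hb, Forces] using hi⟩
      · exact (hi ((hcol i (by simpa using hb)).trans hb.symm)).elim
  -- At `v` itself the condition on the variables is met, yet every disjunct was chosen to fail
  -- there.
  obtain ⟨ψ, hψ, hψv⟩ := (hχ' M v).1
    ((hφ' M hM v).1 (h ⟨hφ, hx⟩).2 v (hM.refl v) (by simp))
  rcases hψ with ⟨y, rfl⟩ | ⟨i, hi, rfl⟩
  · exact hv y hψv
  · exact Bool.false_ne_true (hi.symm.trans hψv)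

/-! Adding a root below a disjoint union. -/

theorem graftRel_some_iff {k : ℕ} {M : Fin k → KModel n} {i : Fin k} {a : (M i).World}
    {y : Option (Σ i, (M i).World)} :
    GraftRel M (some ⟨i, a⟩) y ↔ ∃ b, (M i).rel a b ∧ y = some ⟨i, b⟩ := by
  constructor
  · rintro (_ | ⟨_, _, b, h⟩)
    exact ⟨b, h, rfl⟩
  · rintro ⟨b, h, rfl⟩
    exact .branch i a b h

theorem graftRel_some_some_iff {k : ℕ} {M : Fin k → KModel n} {i : Fin k}
    {a b : (M i).World} : GraftRel M (some ⟨i, a⟩) (some ⟨i, b⟩) ↔ (M i).rel a b := by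
  rw [graftRel_some_iff]
  constructor
  · rintro ⟨b', h, he⟩
    cases he
    exact h
  · exact fun h => ⟨b, h, rfl⟩

theorem isIntuitionistic_graft {c : Color n} {k : ℕ} {M : Fin k → KModel n}
    (hM : ∀ i, (M i).IsIntuitionistic) (hc : ∀ i x, c ≤ (M i).col x) :
    (graft c M).IsIntuitionistic where
  nonempty := ⟨none⟩
  refl
    | none => .root _
    | some ⟨i, a⟩ => .branch i a a ((hM i).refl a)
  trans := by
    rintro _ _ _ (_ | ⟨i, a, b, h⟩) h'
    · exact .root _
    · obtain ⟨d, hd, rfl⟩ := graftRel_some_iff.1 h'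
      exact .branch i a d ((hM i).trans _ _ _ h hd)
  antisymm := by
    rintro _ _ (_ | ⟨i, a, b, h⟩) h'
    · cases h'
      rfl
    · rw [(hM i).antisymm a b h (graftRel_some_some_iff.1 h')]
  persistent := by
    rintro _ x (_ | ⟨i, a, b, h⟩)
    · rcases x with _ | ⟨i, a⟩
      exacts [le_refl c, hc i a]
    · exact (hM i).persistent a b h

theorem isMonotonic_some {c : Color n} {k : ℕ} {M : Fin k → KModel n} (i : Fin k) :
    IsMonotonic (M i) (graft c M) fun a => some ⟨i, a⟩ :=
  ⟨fun a b h => .branch i a b h, fun _ => rfl⟩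

/-- Only points of the same branch lie above a point of a branch, so the inclusion of a branch has
the lifting property. -/
theorem theoryAt_graft_some {c : Color n} {k : ℕ} {M : Fin k → KModel n} {i : Fin k}
    {a : (M i).World} :
    (graft c M).theoryAt (some ⟨i, a⟩) = (M i).theoryAt a := by
  ext φ
  refine and_congr_right fun _ => (isMonotonic_some (c := c) i).forces_iff fun w y h => ?_
  obtain ⟨b, hb, rfl⟩ := graftRel_some_iff.1 h
  exact ⟨b, hb, rfl⟩

/-- Grafts of isomorphic families are isomorphic. -/
def Iso.graft (c : Color n) {k l : ℕ} {M : Fin k → KModel n} {N : Fin l → KModel n}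
    (σ : Fin k ≃ Fin l) (e : ∀ i, Iso (M i) (N (σ i))) :
    Iso (KModel.graft c M) (KModel.graft c N) where
  toEquiv := Equiv.optionCongr
    (Equiv.sigmaCongr (β₂ := fun j => (N j).World) σ fun i => (e i).toEquiv)
  map_rel := by
    rintro (_ | ⟨i, a⟩) u
    · exact iff_of_true (.root _) (.root _)
    · rcases u with _ | ⟨j, b⟩
      · exact iff_of_false nofun nofun
      · constructor
        · intro h
          obtain ⟨b', hb, he⟩ := graftRel_some_iff.1 h
          have hj : σ j = σ i := congrArg Sigma.fst (Option.some.inj he)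
          obtain rfl := σ.injective hj
          cases he
          exact .branch j a b (((e j).map_rel a b).1 hb)
        · rintro (_ | ⟨_, _, b, h⟩)
          exact .branch (M := N) (σ i) _ _ (((e i).map_rel a b).2 h)
  map_col
    | none => rfl
    | some ⟨i, a⟩ => (e i).map_col a

end KModel

/-! Layer trees. -/

namespace CTree

/-- Layer numbers drop out here, leaving conditions suited to structural induction on trees. -/
theorem exists_inLayer_node_iff {c : Color n} {k : ℕ} {sub : Fin k → CTree n} :
    (∃ m, InLayer m (node c k sub)) ↔ (∀ i, ∃ m, InLayer m (sub i)) ∧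
      (∀ i j, i ≠ j → ¬ KModel.Le (sub i).model (sub j).model) ∧
      ∀ i, ∀ x : (sub i).model.World, c < (sub i).model.col x := by
  constructor
  · rintro ⟨_, _ | ⟨m, k, c, sub, l, -, hsub, -, hinc, hc⟩⟩
    · exact ⟨fun i => i.elim0, fun i => i.elim0, fun i => i.elim0⟩
    · exact ⟨fun i => ⟨l i, hsub i⟩, hinc, hc⟩
  · rintro ⟨hsub, hinc, hc⟩
    choose l hl using hsub
    -- The constructor `step` requires a subtree in the layer exactly `m`, so it needs a nonempty
    -- family, and `m` is the largest chosen layer.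
    rcases k with _ | k
    · exact ⟨1, .single c sub⟩
    · obtain ⟨i, hi⟩ := Finite.exists_max l
      exact ⟨l i + 1, .step (l i) (k + 1) c sub l hi hl ⟨i, rfl⟩ hinc hc⟩

instance finite_world (t : CTree n) : Finite t.model.World := by
  induction t with
  | node c k sub ih => exact inferInstanceAs (Finite (Option (Σ i, (sub i).model.World)))

theorem isIntuitionistic_model {t : CTree n} (ht : ∃ m, InLayer m t) :
    t.model.IsIntuitionistic := by
  induction t with
  | node c k sub ih =>
    obtain ⟨hsub, -, hc⟩ := exists_inLayer_node_iff.1 ht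
    exact KModel.isIntuitionistic_graft (fun i => ih i (hsub i)) fun i x => (hc i x).le

/-! ### Comparison of trees by maps, by theories and by isomorphism. -/

theorem color_le_of_le {t u : CTree n} (ht : ∃ m, InLayer m t)
    (h : KModel.Le t.model u.model) : t.color ≤ u.color := by
  obtain ⟨f, hf⟩ := h
  rw [← col_root t, ← col_root u, ← hf.map_col]
  exact (isIntuitionistic_model ht).persistent _ _ (root_rel t _)

/-- The map may send the root of `u` anywhere in `t`: truth persists from the root of `t` to that
image and is then reflected. -/
theorem theory_subset_of_le {t u : CTree n} (ht : ∃ m, InLayer m t)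
    (h : KModel.Le t.model u.model) : t.theory ⊆ u.theory := by
  obtain ⟨f, hf⟩ := h
  exact fun φ hφ => ⟨hφ.1, hf.forces_of_forces hφ.1
    ((isIntuitionistic_model ht).forces_mono (root_rel t _) hφ.2)⟩

/-- The root goes to a world `y` above `x` of matching color, and each subtree is then mapped above
`y`. An arbitrary `x` and the bound on `f` are what the induction needs to glue these maps. -/
theorem exists_isMonotonic_of_theoryAt_subset {N : KModel n} (hN : N.IsIntuitionistic)
    [Finite N.World] {t : CTree n} (ht : ∃ m, InLayer m t) {x : N.World}
    (h : N.theoryAt x ⊆ t.theory) :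
    ∃ f, KModel.IsMonotonic t.model N f ∧ ∀ a, N.rel x (f a) := by
  induction t generalizing x with
  | node c k sub ih =>
    have hint := isIntuitionistic_model ht
    obtain ⟨hsub, -, -⟩ := exists_inLayer_node_iff.1 ht
    obtain ⟨y, hxy, hcol, hy⟩ := hint.exists_rel_of_theoryAt_subset hN h
    have hstep : ∀ i, ∃ f, KModel.IsMonotonic (sub i).model N f ∧ ∀ a, N.rel y (f a) := by
      intro i
      -- The theory at `y` is contained in that of the root, hence by persistence in that of the
      -- root of the subtree.
      refine ih i (hsub i) (hy.trans ((hint.theoryAt_mono (root_rel (node c k sub)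
        (some ⟨i, (sub i).root⟩))).trans ?_))
      exact (KModel.theoryAt_graft_some (M := fun i => (sub i).model)).subset
    choose f hf hyf using hstep
    refine ⟨fun a => a.elim y fun b => f b.1 b.2, ⟨?_, ?_⟩, ?_⟩
    · rintro _ x (_ | ⟨i, a, b, hab⟩)
      · rcases x with _ | ⟨i, a⟩
        exacts [hN.refl y, hyf i a]
      · exact (hf i).map_rel a b hab
    · rintro (_ | ⟨i, a⟩)
      exacts [hcol, (hf i).map_col a]
    · rintro (_ | ⟨i, a⟩)
      exacts [hxy, hN.trans _ _ _ hxy (hyf i a)]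

/-- Trees of the layers are ordered by inclusion of their theories. -/
theorem le_iff_theory_subset {t u : CTree n} (ht : ∃ m, InLayer m t) (hu : ∃ m, InLayer m u) :
    KModel.Le t.model u.model ↔ t.theory ⊆ u.theory := by
  refine ⟨theory_subset_of_le ht, fun h => ?_⟩
  obtain ⟨f, hf, -⟩ :=
    exists_isMonotonic_of_theoryAt_subset (isIntuitionistic_model ht) hu (x := t.root) h
  exact ⟨f, hf⟩

/-- The root of a subtree has color above `c`, so it cannot be sent to the root of the target; the
rest of the subtree then stays in the branch where its root lands. -/
theorem exists_le_sub_of_isMonotonic {c : Color n} {k l : ℕ} {s : Fin k → CTree n}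
    {r : Fin l → CTree n} (hc : ∀ i, ∀ x : (s i).model.World, c < (s i).model.col x)
    {f : (node c k s).model.World → (node c l r).model.World}
    (hf : KModel.IsMonotonic (node c k s).model (node c l r).model f) (i : Fin k) :
    ∃ j, KModel.Le (r j).model (s i).model := by
  rcases hroot : f (some ⟨i, (s i).root⟩) with _ | ⟨j, y⟩
  · have := hf.map_col (some ⟨i, (s i).root⟩)
    rw [hroot] at this
    exact absurd this (hc i (s i).root).ne
  · have hval : ∀ a, ∃ b, f (some ⟨i, a⟩) = some ⟨j, b⟩ := by
      intro a
      have h := hf.map_rel (some ⟨i, (s i).root⟩) (some ⟨i, a⟩)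
        (.branch (M := fun i => (s i).model) i _ a (root_rel (s i) a))
      rw [hroot] at h
      obtain ⟨b, -, hb⟩ := KModel.graftRel_some_iff.1 h
      exact ⟨b, hb⟩
    choose g hg using hval
    refine ⟨j, g, fun a b hab => ?_, fun a => ?_⟩
    · have h := hf.map_rel (some ⟨i, a⟩) (some ⟨i, b⟩)
        (.branch (M := fun i => (s i).model) i a b hab)
      rw [hg, hg] at h
      exact KModel.graftRel_some_some_iff.1 h
    · have h := hf.map_col (some ⟨i, a⟩)
      rw [hg] at h
      exact h

/-- The two maps match subtrees with subtrees. Going back and forth compares a subtree with another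
one of the same tree, so incomparability makes the matchings mutually inverse and the matched
subtrees `≤` each other. -/
theorem nonempty_iso_of_le_of_le {t u : CTree n} (ht : ∃ m, InLayer m t)
    (hu : ∃ m, InLayer m u) (htu : KModel.Le t.model u.model)
    (hut : KModel.Le u.model t.model) : Nonempty (KModel.Iso t.model u.model) := by
  induction t generalizing u with
  | node c k s ih =>
    rcases u with ⟨d, l, r⟩
    obtain rfl : c = d := le_antisymm (color_le_of_le ht htu) (color_le_of_le hu hut)
    obtain ⟨hs, hincs, hcs⟩ := exists_inLayer_node_iff.1 ht
    obtain ⟨hr, hincr, hcr⟩ := exists_inLayer_node_iff.1 hu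
    obtain ⟨g, hg⟩ := htu
    obtain ⟨f, hf⟩ := hut
    choose p hp using exists_le_sub_of_isMonotonic hcs hf
    choose q hq using exists_le_sub_of_isMonotonic hcr hg
    have hqp : ∀ i, q (p i) = i := fun i => by
      by_contra hne
      exact hincs _ _ hne ((hq (p i)).trans (hp i))
    have hpq : ∀ j, p (q j) = j := fun j => by
      by_contra hne
      exact hincr _ _ hne ((hp (q j)).trans (hq j))
    have e : ∀ i, Nonempty (KModel.Iso (s i).model (r (p i)).model) := fun i =>
      ih i (hs i) (hr _) (by simpa only [hqp] using hq (p i)) (hp i)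
    exact ⟨KModel.Iso.graft c ⟨p, q, hqp, hpq⟩ fun i => (e i).some⟩

/-- Every world of an intuitionistic model has the theory of some tree of the layers. -/
theorem exists_theory_eq {M : KModel n} (hM : M.IsIntuitionistic) (w : M.World) :
    ∃ t : CTree n, (∃ m, InLayer m t) ∧ t.theory = M.theoryAt w := by
  induction hcw : M.col w using WellFoundedGT.induction generalizing w with
  | ind c ih =>
    subst hcw
    let S : Set (Set (Form n)) := {T | ∃ v, M.rel w v ∧ M.col w < M.col v ∧ M.theoryAt v = T}
    have hS : S.Finite := hM.finite_range_theoryAt.subset fun T ⟨v, _, _, hv⟩ => ⟨v, hv⟩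
    -- Minimal theories suffice because `theoryAt_subset` asks only for an inclusion, and minimality
    -- is what makes the subtrees incomparable.
    have hX : {T | Minimal (· ∈ S) T}.Finite := hS.subset fun T hT => hT.prop
    have := hX.to_subtype
    obtain ⟨k, ⟨σ⟩⟩ := Finite.exists_equiv_fin {T | Minimal (· ∈ S) T}
    have hmem : ∀ i, ∃ v, M.rel w v ∧ M.col w < M.col v ∧ M.theoryAt v = (σ.symm i).1 :=
      fun i => (σ.symm i).2.prop
    choose v hwv hlt hv using hmem
    choose sub hsub hth using fun i => ih _ (hlt i) (v i) rfl
    have ht : ∃ m, InLayer m (node (M.col w) k sub) := by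
      refine exists_inLayer_node_iff.2 ⟨hsub, fun i j hij hle => hij ?_, fun i x => ?_⟩
      · have hle' : (σ.symm i).1 ⊆ (σ.symm j).1 := by
          rw [← hv, ← hv, ← hth, ← hth]
          exact theory_subset_of_le (hsub i) hle
        exact σ.symm.injective
          (Subtype.ext ((σ.symm j).2.eq_of_le (σ.symm i).2.prop hle'))
      · calc M.col w < M.col (v i) := hlt i
          _ = (sub i).model.col (sub i).root := (KModel.col_eq_of_theoryAt_eq (hth i)).symm
          _ ≤ _ := (isIntuitionistic_model (hsub i)).persistent _ _ (root_rel _ x)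
    have hint := isIntuitionistic_model ht
    have hgraft : ∀ i (a : (sub i).model.World),
        (node (M.col w) k sub).model.theoryAt (some ⟨i, a⟩) = (sub i).model.theoryAt a :=
      fun i a => KModel.theoryAt_graft_some (M := fun i => (sub i).model)
    refine ⟨_, ht, Set.Subset.antisymm ?_ ?_⟩
    -- A world `u` of larger color is matched by the root of the subtree for a minimal theory inside
    -- that of `u`.
    · refine hM.theoryAt_subset (v := (node (M.col w) k sub).root) hint rfl fun u hu hcu => ?_
      obtain ⟨T, hT, hTmin⟩ := hS.exists_le_minimal ⟨u, hu, hcu, rfl⟩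
      refine ⟨some ⟨σ ⟨T, hTmin⟩, (sub _).root⟩, root_rel _ _, ?_⟩
      rw [hgraft]
      refine ((hth _).trans (hv _)).subset.trans ?_
      simpa using hT
    -- A point of the subtree `i` is matched by `v i`, whose theory is that of the subtree's root.
    · refine hint.theoryAt_subset (w := (node (M.col w) k sub).root) hM rfl ?_
      rintro (_ | ⟨i, a⟩) - hcu
      · exact (lt_irrefl _ hcu).elim
      · refine ⟨v i, hwv i, ?_⟩
        rw [hgraft, ← hth i]
        exact (isIntuitionistic_model (hsub i)).theoryAt_mono (root_rel _ a)

end CTree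

/-! The canonical and the universal model. -/

theorem isIntuitionistic_canonicalModel (n : ℕ) : (canonicalModel n).IsIntuitionistic where
  nonempty :=
    have ht : ∃ m, CTree.InLayer m (.node (fun _ => false) 0 nofun : CTree n) :=
      ⟨1, .single _ _⟩
    ⟨_, (CTree.isIntuitionistic_model ht).isPrimeNNILTheory_theoryAt (CTree.root _)⟩
  refl _ := Set.Subset.rfl
  trans _ _ _ := Set.Subset.trans
  antisymm _ _ h h' := Subtype.ext (Set.Subset.antisymm h h')
  persistent Γ Δ h i hi := by
    simp only [canonicalModel, decide_eq_true_eq] at hi ⊢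
    exact h hi

/-- The truth lemma for the canonical model. -/
theorem forces_canonicalModel_iff {φ : Form n} (hφ : φ.IsNNIL) (Γ : (canonicalModel n).World) :
    (canonicalModel n).Forces Γ φ ↔ φ ∈ Γ.1 := by
  induction φ generalizing Γ with
  | bot => exact iff_of_false id fun h => Γ.2.consistent (.ax h)
  | var i => simp [KModel.Forces, canonicalModel]
  | and φ ψ ihφ ihψ =>
    refine (and_congr (ihφ hφ.1 Γ) (ihψ hφ.2 Γ)).trans ⟨fun h => ?_, fun h => ⟨?_, ?_⟩⟩
    · exact Γ.2.closed _ hφ (.andI (.ax h.1) (.ax h.2))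
    · exact Γ.2.closed _ hφ.1 (.andE₁ (.ax h))
    · exact Γ.2.closed _ hφ.2 (.andE₂ (.ax h))
  | or φ ψ ihφ ihψ =>
    refine (or_congr (ihφ hφ.1 Γ) (ihψ hφ.2 Γ)).trans ⟨fun h => ?_, Γ.2.disj φ ψ⟩
    exact Γ.2.closed _ hφ (h.elim (fun h => .orI₁ (.ax h)) fun h => .orI₂ (.ax h))
  | imp φ ψ ihφ ihψ =>
    -- The antecedent is itself NNIL, so adjoining it to `Γ` stays among NNIL-formulas and the
    -- extension lemma applies.
    have hφ' := hφ.1.isNNIL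
    constructor
    · intro h
      by_contra hn
      have hnd : ¬ IPC (insert φ Γ.1) ψ := fun hd => hn (Γ.2.closed _ hφ (.impI hd))
      obtain ⟨Δ, hΓΔ, hΔ, hψ⟩ := IPC.exists_isPrimeNNILTheory (by
        rintro χ (rfl | hχ)
        exacts [hφ', Γ.2.isNNIL χ hχ]) hnd
      exact hψ ((ihψ hφ.2 ⟨Δ, hΔ⟩).1 (h ⟨Δ, hΔ⟩ ((Set.subset_insert _ _).trans hΓΔ)
        ((ihφ hφ' ⟨Δ, hΔ⟩).2 (hΓΔ (Set.mem_insert _ _)))))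
    · intro h Δ hΔ hf
      exact (ihψ hφ.2 Δ).2 (Δ.2.closed _ hφ.2
        (.impE (.ax (hΔ h)) (.ax ((ihφ hφ' Δ).1 hf))))

theorem theoryAt_canonicalModel (Γ : (canonicalModel n).World) :
    (canonicalModel n).theoryAt Γ = Γ.1 :=
  Set.ext fun φ => ⟨fun h => (forces_canonicalModel_iff h.1 Γ).1 h.2, fun h =>
    have hφ := Γ.2.isNNIL φ h
    ⟨hφ, (forces_canonicalModel_iff hφ Γ).2 h⟩⟩

/-! ### The isomorphism between the two models. -/

theorem isIntuitionistic_universalModel (n : ℕ) : (universalModel n).IsIntuitionistic where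
  nonempty := ⟨Quotient.mk (LayerTree.setoid n) ⟨.node (fun _ => false) 0 nofun, 1, .single _ _⟩⟩
  refl := by
    rintro ⟨t⟩
    exact (KModel.Iso.refl t.1.model).le
  trans := by
    rintro ⟨t⟩ ⟨u⟩ ⟨r⟩ h h'
    exact KModel.Le.trans h h'
  antisymm := by
    rintro ⟨t⟩ ⟨u⟩ h h'
    exact Quotient.sound (CTree.nonempty_iso_of_le_of_le t.2 u.2 h h')
  persistent := by
    rintro ⟨t⟩ ⟨u⟩ h
    exact CTree.color_le_of_le t.2 h

/-- The map that sends a tree to its theory. -/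
def universalModel.toCanonical (n : ℕ) : (universalModel n).World → (canonicalModel n).World :=
  Quotient.lift (fun t : LayerTree n => (⟨t.1.theory,
      (CTree.isIntuitionistic_model t.2).isPrimeNNILTheory_theoryAt t.1.root⟩ :
      {Γ : Set (Form n) // IsPrimeNNILTheory Γ})) (by
    rintro t u ⟨e⟩
    exact Subtype.ext (Set.Subset.antisymm (CTree.theory_subset_of_le t.2 e.symm.le)
      (CTree.theory_subset_of_le u.2 e.le)))

theorem universalModel.toCanonical_rel_iff (w u : (universalModel n).World) :
    (canonicalModel n).rel (toCanonical n w) (toCanonical n u) ↔ (universalModel n).rel w u := by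
  rcases w with ⟨t⟩
  rcases u with ⟨u⟩
  exact (CTree.le_iff_theory_subset t.2 u.2).symm

theorem universalModel.toCanonical_bijective (n : ℕ) : Function.Bijective (toCanonical n) := by
  constructor
  · intro w u h
    exact (isIntuitionistic_universalModel n).antisymm w u
      ((toCanonical_rel_iff w u).1 (congrArg Subtype.val h).subset)
      ((toCanonical_rel_iff u w).1 (congrArg Subtype.val h).superset)
  · intro Γ
    obtain ⟨t, ht, hΓ⟩ := CTree.exists_theory_eq (isIntuitionistic_canonicalModel n) Γ
    exact ⟨Quotient.mk (LayerTree.setoid n) ⟨t, ht⟩,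
      Subtype.ext (hΓ.trans (theoryAt_canonicalModel Γ))⟩

/-- The universal model is isomorphic to the canonical model. -/
noncomputable def universalModel.isoCanonical (n : ℕ) :
    KModel.Iso (universalModel n) (canonicalModel n) where
  toEquiv := Equiv.ofBijective _ (toCanonical_bijective n)
  map_rel := toCanonical_rel_iff
  map_col := by
    rintro ⟨t⟩
    refine (KModel.col_eq_of_theoryAt_eq (M := canonicalModel n) (N := t.1.model) (v := t.1.root)
      ?_).trans t.1.col_root
    exact theoryAt_canonicalModel _

theorem theorem4p12 (n : ℕ) :
    (universalModel n).IsIntuitionistic ∧ (canonicalModel n).IsIntuitionistic ∧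
    ∃ e : KModel.Iso (universalModel n) (canonicalModel n),
      (∀ t : LayerTree n,
        (e.toEquiv (Quotient.mk (LayerTree.setoid n) t)).1 = t.1.theory) ∧
      (∀ a : (universalModel n).World,
        (e.toEquiv a).1 = {φ : Form n | φ.IsNNIL ∧ (universalModel n).Forces a φ}) := by
  refine ⟨isIntuitionistic_universalModel n, isIntuitionistic_canonicalModel n,
    universalModel.isoCanonical n, fun t => rfl, fun a => ?_⟩
  -- For truth at a world of the universal model: the isomorphism preserves forcing, and in the
  -- canonical model forcing of NNIL-formulas is membership.
  rw [← theoryAt_canonicalModel]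
  exact Set.ext fun φ => and_congr_right fun _ => KModel.Iso.forces_iff _
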